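/- Let $\mathcal G$ be a Grothendieck category (a cocomplete abelian category with a generator and exact directed colimits), let $G$ be an arbitrary sofic group (not necessarily finitely generated), and let $N\in\mathcal G$ be a Noetherian object, i.e. the lattice of subobjects of $N$ satisfies the ascending chain condition. Let $\mathcal G^G$ be the category of representations of $G$ on $\mathcal G$: its objects are the pairs $(X,\lambda)$ with $X\in\mathcal G$ and $\lambda\colon G\to\mathrm{Aut}_{\mathcal G}(X)$ a group homomorphism, and its morphisms are the $G$-equivariant morphisms of $\mathcal G$. Let $\uparrow_{\mathbf 1}^G\colon\mathcal G\to\mathcal G^G$ be the left adjoint of the forgetful functor $(X,\lambda)\mapsto X$; explicitly, $\uparrow_{\mathbf 1}^G N$ is the coproduct $N^{(G)}$ of copies of $N$ indexed by $G$, on which $g\in G$ acts by mapping the copy of index $h$ identically onto the copy of index $gh$. Then the ring $\mathrm{End}_{\mathcal G^G}(\uparrow_{\mathbf 1}^G N)$ is directly finite, that is, $\phi\psi=1$ implies $\psi\phi=1$ for all of its elements $\phi,\psi$. Here soficity is defined as follows. For a set $B$, a $B$-labeled digraph is a set $V$ of vertices with a set $E\subseteq V\times V$ of edges and a map $E\to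 B$. For a vertex $v$ and $n\in\mathbb N$, the neighborhood $N_n(v)$ is the labeled digraph induced on the set of vertices that can be reached from $v$ by a directed path with at most $n$ edges. Isomorphisms of $B$-labeled digraphs are bijections of the vertices that preserve and reflect edges and preserve labels. If $B$ is a finite symmetric set of generators of a group $H$, the Cayley graph $\Gamma(H,B)$ is the $B$-labeled digraph with vertex set $H$ and edges $(h,hb)$, for $h\in H$ and $b\in B$, such an edge having the label $b$; let $N_n(B)$ be the $n$-th neighborhood of $1$ in it. A finitely generated group $H$ is sofic if for every finite symmetric set of generators $B$ of $H$, every $\varepsilon\in(0,1)$ and every $r\in\mathbb N$ there are a finite $B$-labeled digraph with non-empty vertex set $V$ and a subset $V_0\subseteq V$ with $|V_0|\ge(1-\varepsilon)|V|$ such that $N_r(v)\cong N_r(B)$ as $B$-labeled digraphs for each $v\in V_0$. An arbitrary group is sofic if each of its finitely generated subgroups is sofic. -/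

import Mathlib

open CategoryTheory CategoryTheory.Limits

universe v u

/-- A digraph on the vertex type `V` (a set of ordered pairs of vertices, the edges) together with
a map from the set of its edges to the set `B` of labels. -/
structure LabeledDigraph (B V : Type*) extends Digraph V where
  /-- the label of an edge -/
  label : ∀ {v w : V}, Adj v w → B

namespace LabeledDigraph

variable {B V W : Type*}

/-- An isomorphism of `B`-labeled digraphs: a bijection of the vertices which preserves and
reflects edges and preserves their labels. -/
structure Iso (Γ₁ : LabeledDigraph B V) (Γ₂ : LabeledDigraph B W) extends V ≃ W where
  adj_iff : ∀ v w : V, Γ₁.Adj v w ↔ Γ₂.Adj (toFun v) (toFun w)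
  label_eq : ∀ (v w : V) (h : Γ₁.Adj v w), Γ₁.label h = Γ₂.label ((adj_iff v w).1 h)

/-- The labeled digraph induced on a set of vertices. -/
def induce (Γ : LabeledDigraph B V) (s : Set V) : LabeledDigraph B s where
  Adj x y := Γ.Adj x.1 y.1
  label h := Γ.label h

/-- `Γ.IsPath n v w`: there is a directed path (repetitions allowed) with exactly `n` edges
from `v` to `w`. -/
def IsPath (Γ : LabeledDigraph B V) : ℕ → V → V → Prop
  | 0, v, w => v = w
  | n + 1, v, w => ∃ x, Γ.IsPath n v x ∧ Γ.Adj x w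

/-- The number of edges in a shortest directed path from `v` to `w`, and `⊤` if there is none. -/
noncomputable def dist (Γ : LabeledDigraph B V) (v w : V) : ℕ∞ :=
  ⨅ (n : ℕ) (_ : Γ.IsPath n v w), (n : ℕ∞)

/-- The set of vertices of the `n`-th neighborhood of `v`. -/
def nbhdSet (Γ : LabeledDigraph B V) (n : ℕ) (v : V) : Set V :=
  {w | Γ.dist v w ≤ n}

theorem mem_nbhdSet_iff (Γ : LabeledDigraph B V) (n : ℕ) (v w : V) :
    w ∈ Γ.nbhdSet n v ↔ ∃ m ≤ n, Γ.IsPath m v w := by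
  constructor
  · intro h
    by_contra hcon
    push Not at hcon
    have h1 : ((n + 1 : ℕ) : ℕ∞) ≤ Γ.dist v w := by
      refine le_iInf₂ fun m hm => ?_
      have : n < m := by
        by_contra hlt
        exact hcon m (not_lt.1 hlt) hm
      exact_mod_cast this
    have h2 : ((n + 1 : ℕ) : ℕ∞) ≤ (n : ℕ∞) := h1.trans h
    have h3 : n + 1 ≤ n := by exact_mod_cast h2
    omega
  · rintro ⟨m, hm, hp⟩
    exact (iInf₂_le (f := fun (k : ℕ) (_ : Γ.IsPath k v w) => (k : ℕ∞)) m hp).trans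
      (by exact_mod_cast hm)

/-- The `n`-th neighborhood of `v`, as a labeled digraph. -/
def nbhd (Γ : LabeledDigraph B V) (n : ℕ) (v : V) : LabeledDigraph B (Γ.nbhdSet n v) :=
  Γ.induce (Γ.nbhdSet n v)

end LabeledDigraph

/-- The Cayley graph of `G` with respect to `B`: its edges are the pairs `(g, g * b)` with `b ∈ B`,
and such an edge has the label `b`. -/
def cayleyDigraph {G : Type*} [Group G] (B : Finset G) : LabeledDigraph B G where
  Adj g h := g⁻¹ * h ∈ B
  label {g h} hgh := ⟨g⁻¹ * h, hgh⟩

theorem cayleyDigraph_adj_iff {G : Type*} [Group G] (B : Finset G) (g h : G) :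
    (cayleyDigraph B).Adj g h ↔ ∃ b ∈ B, h = g * b :=
  ⟨fun H => ⟨g⁻¹ * h, H, by simp⟩, by rintro ⟨b, hb, rfl⟩; simpa [cayleyDigraph] using hb⟩

/-- Soficity of a finitely generated group `G`: for every finite symmetric set of generators `B`,
every `ε ∈ (0, 1)` and every `r`, there is a finite non-empty `B`-labeled digraph such that the
`r`-neighborhoods of at least `(1 - ε)|V|` of its vertices are isomorphic to the `r`-neighborhood
of `1` in the Cayley graph. -/
def IsSoficFG (G : Type*) [Group G] : Prop :=
  ∀ B : Finset G, (∀ b ∈ B, b⁻¹ ∈ B) → Subgroup.closure (B : Set G) = ⊤ →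
    ∀ ε : ℝ, 0 < ε → ε < 1 → ∀ r : ℕ,
      ∃ (V : Type) (_ : Fintype V) (_ : Nonempty V) (Γ : LabeledDigraph B V) (V₀ : Finset V),
        (1 - ε) * (Fintype.card V : ℝ) ≤ (V₀.card : ℝ) ∧
        ∀ v ∈ V₀, Nonempty ((Γ.nbhd r v).Iso ((cayleyDigraph B).nbhd r 1))

/-- An arbitrary group is sofic if each of its finitely generated subgroups is sofic. -/
def IsSofic (G : Type*) [Group G] : Prop :=
  ∀ H : Subgroup G, H.FG → IsSoficFG H

section Induction

variable {C : Type u} [Category.{v} C] (G : Type v) [Group G] [HasCoproducts.{v} C]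

/-- The representation induced by an object `X`: the coproduct of copies of `X` indexed by `G`, on
which `g` acts by the Bernoulli shift, mapping the copy of index `h` identically onto the copy of
index `g * h`. -/
noncomputable def inducedRep (X : C) : Action C G where
  V := ∐ fun _ : G => X
  ρ :=
    { toFun := fun g => Sigma.desc fun h : G => Sigma.ι (fun _ : G => X) (g * h)
      map_one' := by
        refine Sigma.hom_ext _ _ fun h => ?_
        simp
      map_mul' := fun g g' => by
        refine Sigma.hom_ext _ _ fun h => ?_
        simp [mul_assoc] }

/-- The inclusion of the copy of index `g` into the representation induced by `X`. -/
noncomputable def inducedRepι (X : C) (g : G) : X ⟶ (inducedRep G X).V :=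
  Sigma.ι (fun _ : G => X) g

/-- The universal property of the coproduct underlying the representation induced by `X`. -/
noncomputable def inducedRepDesc (X : C) {Y : C} (f : G → (X ⟶ Y)) : (inducedRep G X).V ⟶ Y :=
  Sigma.desc f

@[simp]
theorem inducedRepι_desc (X : C) {Y : C} (f : G → (X ⟶ Y)) (g : G) :
    inducedRepι G X g ≫ inducedRepDesc G X f = f g :=
  Sigma.ι_desc _ _

theorem inducedRep_hom_ext (X : C) {Y : C} {a b : (inducedRep G X).V ⟶ Y}
    (h : ∀ g, inducedRepι G X g ≫ a = inducedRepι G X g ≫ b) : a = b :=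
  Sigma.hom_ext _ _ h

theorem inducedRepι_ρ (X : C) (g h : G) :
    inducedRepι G X h ≫ (inducedRep G X).ρ g = inducedRepι G X (g * h) :=
  Sigma.ι_desc _ _

/-- A morphism `X ⟶ A.V` extends uniquely to an equivariant morphism from the representation
induced by `X`. -/
noncomputable def inducedRepHomEquiv (X : C) (A : Action C G) :
    (inducedRep G X ⟶ A) ≃ (X ⟶ A.V) where
  toFun φ := inducedRepι G X 1 ≫ φ.hom
  invFun f :=
    { hom := inducedRepDesc G X fun h : G => f ≫ A.ρ h
      comm := fun g => by
        refine inducedRep_hom_ext G X fun h => ?_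
        rw [← Category.assoc, inducedRepι_ρ, ← Category.assoc, inducedRepι_desc,
          inducedRepι_desc, map_mul, End.mul_def, Category.assoc] }
  left_inv φ := by
    refine Action.hom_ext _ _ (inducedRep_hom_ext G X fun h => ?_)
    have := inducedRepι_ρ G X h 1
    rw [mul_one] at this
    rw [inducedRepι_desc, Category.assoc, ← φ.comm, ← Category.assoc, this]
  right_inv f := by
    change inducedRepι G X 1 ≫ inducedRepDesc G X (fun h : G => f ≫ A.ρ h) = f
    rw [inducedRepι_desc, map_one, End.one_def, Category.comp_id]

/-- The extension functor from a category to the category of representations of `G` on it. -/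
noncomputable def inductionFunctor : C ⥤ Action C G :=
  Adjunction.leftAdjointOfEquiv (F_obj := inducedRep G) (G := Action.forget C G)
    (inducedRepHomEquiv G) (fun X _ _ g h => (Category.assoc (inducedRepι G X 1) h.hom g.hom).symm)

/-- The extension functor is left adjoint to the restriction (forgetful) functor. -/
noncomputable def inductionAdjunction :
    inductionFunctor (C := C) G ⊣ Action.forget C G :=
  Adjunction.adjunctionOfEquivLeft _ _

theorem inductionFunctor_obj (X : C) : (inductionFunctor G).obj X = inducedRep G X := rfl

end Induction

/-! A morphism from the Noetherian object `N` to a coproduct of copies of `N` lands in a finite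
subcoproduct. So the endomorphisms of the induced representation embed into the group ring of `G`
over `End N` (`inducedRepEndHom`), and it suffices that this ring is directly finite.

If matrices over `R` carry a suitable rank (`MatrixRank`), soficity gives this for `R[G]`. Let `a *
b = 1`, and let `a`, `b` act on a sofic approximation by matrices `A₁`, `A₂`. The rows of `1 - A₁ *
A₂` at good vertices vanish, so its rank is small. If `b * a ≠ 1`, every good row of `1 - A₂ * A₁`
has a nonzero entry, and far apart rows are independent, so its rank is at least a fixed fraction of
the number of good vertices. But the two ranks agree. For `R = End M`, with `M` torsion-free and of
finite length relative to a Serre class, the length of the image is such a rank (`endMatrixRank`).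

The general case is Noetherian induction over the quotients `Q` of `N`. Relative to the torsion
class cogenerated by `Q`, the largest subobject `M` of finite length is nonzero and fully invariant.
The idempotent `1 - b * a` dies over `End M` by the rank argument and over `End (Q/M)` by induction;
hence its square is zero, and so is the idempotent itself. -/

open scoped ZeroObject

/-! ### Length relative to a Serre class. -/

section Length

variable {C : Type u} [Category.{v} C] [Abelian C] (T : ObjectProperty C)

/-- `X` has a filtration with at least `n` factors which do not belong to `T`. -/
def HasLengthGE : ℕ → C → Prop
  | 0, _ => True
  | n + 1, X => ∃ (A : C) (i : A ⟶ X) (_ : Mono i), HasLengthGE n A ∧ ¬ T (cokernel i)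

variable {T}

section

variable [T.IsSerreClass]

/-- The top factor `A/A'` of a chain in `A` embeds into `X/A'`, so `A` may be replaced by `X`. -/
theorem HasLengthGE.of_mono {n : ℕ} {A X : C} (h : HasLengthGE T n A) (i : A ⟶ X) [Mono i] :
    HasLengthGE T n X := by
  cases n with
  | zero => trivial
  | succ n =>
    obtain ⟨A', j, _, h1, h2⟩ := h
    refine ⟨A', j ≫ i, inferInstance, h1, fun h3 => h2 ?_⟩
    have sq : IsPullback j (𝟙 A') i (j ≫ i) :=
      IsPullback.of_isLimit' ⟨by simp⟩ (PullbackCone.IsLimit.mk _ (fun s => s.snd)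
        (fun s => by rw [← cancel_mono i, Category.assoc, s.condition]) (by simp)
        (fun s m _ hm => by simpa using hm))
    have : Mono (cokernel.map j (j ≫ i) (𝟙 A') i sq.w) :=
      Abelian.mono_cokernel_map_of_isPullback sq
    exact T.prop_of_mono (cokernel.map j (j ≫ i) (𝟙 A') i sq.w) h3

theorem HasLengthGE.pred {n : ℕ} {X : C} (h : HasLengthGE T (n + 1) X) : HasLengthGE T n X := by
  obtain ⟨A', j, _, h1, -⟩ := h
  exact h1.of_mono j

/-- Preimages of a chain in `X₃` continue a chain in `X₁`: the preimage of `C'` is an extension of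
`C'` by `X₁`. -/
theorem HasLengthGE.add {S : ShortComplex C} (hS : S.ShortExact) {m n : ℕ}
    (h₁ : HasLengthGE T m S.X₁) (h₃ : HasLengthGE T n S.X₃) : HasLengthGE T (m + n) S.X₂ := by
  have := hS.mono_f
  have := hS.epi_g
  induction n generalizing S with
  | zero => exact h₁.of_mono S.f
  | succ n ih =>
    obtain ⟨C', j, _, h2, h3⟩ := h₃
    let f' : S.X₁ ⟶ pullback S.g j := pullback.lift S.f 0 (by simp)
    have hf' : f' ≫ pullback.fst S.g j = S.f := pullback.lift_fst _ _ _
    have : Mono f' := mono_of_mono_fac hf'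
    have hS' : (ShortComplex.mk f' (pullback.snd S.g j) (pullback.lift_snd _ _ _)).ShortExact :=
      { exact := by
          refine ShortComplex.exact_of_f_is_kernel _ (KernelFork.IsLimit.ofι' _ _ fun {W} k hk => ?_)
          refine ⟨hS.exact.lift (k ≫ pullback.fst S.g j) ?_, ?_⟩
          · rw [Category.assoc, pullback.condition, reassoc_of% hk, zero_comp]
          · refine pullback.hom_ext ?_ ?_
            · rw [Category.assoc, hf', ShortComplex.Exact.lift_f]
            · have hf0 : f' ≫ pullback.snd S.g j = 0 := pullback.lift_snd _ _ _
              simp only at hk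
              rw [Category.assoc, hf0, comp_zero, hk] }
    refine ⟨pullback S.g j, pullback.fst S.g j, inferInstance,
      ih hS' h₁ h2 inferInstance inferInstance, fun h => h3 ?_⟩
    exact T.prop_of_epi
      (cokernel.map (pullback.fst S.g j) j (pullback.snd S.g j) S.g pullback.condition) h

/-- A chain in `X₂` is intersected with `X₁` and projected to `X₃`. Each factor is the middle term
of an exact sequence between the two resulting factors, so if it lies outside `T`, one of them does.
-/
theorem HasLengthGE.exists_add {S : ShortComplex C} (hS : S.ShortExact) {k : ℕ}
    (h : HasLengthGE T k S.X₂) :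
    ∃ m n, m + n = k ∧ HasLengthGE T m S.X₁ ∧ HasLengthGE T n S.X₃ := by
  have := hS.mono_f
  have := hS.epi_g
  induction k generalizing S with
  | zero => exact ⟨0, 0, rfl, trivial, trivial⟩
  | succ k ih =>
    obtain ⟨X', i, _, h1, h2⟩ := h
    have hS' : (ShortComplex.mk (kernel.ι (i ≫ S.g)) (factorThruImage (i ≫ S.g))
        (by simp [← cancel_mono (image.ι (i ≫ S.g))])).ShortExact :=
      { exact := by
          refine ShortComplex.exact_of_f_is_kernel _ (KernelFork.IsLimit.ofι' _ _ fun {W} l hl => ?_)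
          refine ⟨kernel.lift _ l ?_, kernel.lift_ι _ _ _⟩
          rw [← image.fac (i ≫ S.g), reassoc_of% hl, zero_comp] }
    obtain ⟨m, n, rfl, hm, hn⟩ := ih hS' h1 inferInstance inferInstance
    let a : kernel (i ≫ S.g) ⟶ S.X₁ :=
      hS.exact.lift (kernel.ι (i ≫ S.g) ≫ i) (by simp)
    have ha : a ≫ S.f = kernel.ι (i ≫ S.g) ≫ i := ShortComplex.Exact.lift_f _ _ _
    have hc : i ≫ S.g = factorThruImage (i ≫ S.g) ≫ image.ι (i ≫ S.g) := by simp
    have : Mono (a ≫ S.f) := by rw [ha]; infer_instance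
    have : Mono a := mono_of_mono a S.f
    by_cases hTa : T (cokernel a)
    · by_cases hTc : T (cokernel (image.ι (i ≫ S.g)))
      · exfalso
        refine h2 ?_
        let p := cokernel.map a i (kernel.ι (i ≫ S.g)) S.f ha
        let q := cokernel.map i (image.ι (i ≫ S.g)) (factorThruImage (i ≫ S.g)) S.g hc
        have hp : cokernel.π a ≫ p = S.f ≫ cokernel.π i := cokernel.π_desc _ _ _
        have hq : cokernel.π i ≫ q = S.g ≫ cokernel.π (image.ι (i ≫ S.g)) :=
          cokernel.π_desc _ _ _
        have hpq : p ≫ q = 0 := by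
          rw [← cancel_epi (cokernel.π a), reassoc_of% hp, hq, S.zero_assoc]
          simp
        have hex : (ShortComplex.mk p q hpq).Exact := by
          refine ShortComplex.exact_of_g_is_cokernel _
            (CokernelCofork.IsColimit.ofπ' _ _ fun {Z} h hh => ?_)
          have e1 : S.f ≫ cokernel.π i ≫ h = 0 := by
            rw [← reassoc_of% hp]
            simp only at hh
            rw [hh, comp_zero]
          have e2 : S.g ≫ hS.exact.desc (cokernel.π i ≫ h) e1 = cokernel.π i ≫ h :=
            ShortComplex.Exact.g_desc _ _ _
          refine ⟨cokernel.desc _ (hS.exact.desc (cokernel.π i ≫ h) e1) ?_, ?_⟩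
          · rw [← cancel_epi (factorThruImage (i ≫ S.g)), image.fac_assoc, Category.assoc, e2]
            simp
          · rw [← cancel_epi (cokernel.π i), reassoc_of% hq, cokernel.π_desc, e2]
        exact T.prop_X₂_of_exact hex hTa hTc
      · exact ⟨m, n + 1, rfl, hm.of_mono a, _, image.ι (i ≫ S.g), inferInstance, hn, hTc⟩
    · exact ⟨m + 1, n, by omega, ⟨_, a, inferInstance, hm, hTa⟩, hn.of_mono (image.ι _)⟩

end

variable (T)

/-- The length of an object relative to `T`: the supremum of the numbers of factors outside `T`
in its finite filtrations. -/
noncomputable def relLength (X : C) : ℕ∞ := ⨆ (n : ℕ) (_ : HasLengthGE T n X), (n : ℕ∞)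

variable [T.IsSerreClass]

variable {T} in
theorem HasLengthGE.of_le {m n : ℕ} {X : C} (h : HasLengthGE T n X) (hmn : m ≤ n) :
    HasLengthGE T m X := by
  induction n, hmn using Nat.le_induction with
  | base => exact h
  | succ n _ ih => exact ih h.pred

theorem coe_le_relLength_iff (n : ℕ) (X : C) : (n : ℕ∞) ≤ relLength T X ↔ HasLengthGE T n X := by
  constructor
  · intro h
    by_contra hn
    cases n with
    | zero => exact hn trivial
    | succ n =>
      have : relLength T X ≤ n := by
        refine iSup₂_le fun m hm => ?_
        have : m ≤ n := by
          by_contra hlt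
          exact hn (hm.of_le (by omega))
        exact_mod_cast this
      have h3 : n + 1 ≤ n := by exact_mod_cast h.trans this
      omega
  · intro h
    exact le_iSup₂_of_le (f := fun (n : ℕ) (_ : HasLengthGE T n X) => (n : ℕ∞)) n h le_rfl

theorem relLength_eq_add {S : ShortComplex C} (hS : S.ShortExact) :
    relLength T S.X₂ = relLength T S.X₁ + relLength T S.X₃ := by
  apply le_antisymm
  · refine iSup₂_le fun k hk => ?_
    obtain ⟨m, n, rfl, hm, hn⟩ := hk.exists_add hS
    rw [Nat.cast_add]
    exact add_le_add ((coe_le_relLength_iff T _ _).2 hm) ((coe_le_relLength_iff T _ _).2 hn)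
  · have key (m n : ℕ) (hm : (m : ℕ∞) ≤ relLength T S.X₁) (hn : (n : ℕ∞) ≤ relLength T S.X₃) :
        (m : ℕ∞) + n ≤ relLength T S.X₂ := by
      rw [coe_le_relLength_iff] at hm hn
      exact_mod_cast (coe_le_relLength_iff T _ _).2 (hm.add hS hn)
    refine ENat.forall_natCast_le_iff_le.1 fun k hk => ?_
    by_cases h1 : relLength T S.X₁ = ⊤
    · exact le_trans (by simp) (key k 0 (by simp [h1]) (by simp))
    · by_cases h3 : relLength T S.X₃ = ⊤
      · exact le_trans (by simp) (key 0 k (by simp) (by simp [h3]))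
      · lift relLength T S.X₁ to ℕ using h1 with x
        lift relLength T S.X₃ to ℕ using h3 with y
        exact hk.trans (key x y le_rfl le_rfl)

theorem relLength_le_of_mono {A X : C} (i : A ⟶ X) [Mono i] : relLength T A ≤ relLength T X :=
  iSup₂_le fun n hn => (coe_le_relLength_iff T n X).2 (hn.of_mono i)

theorem shortExact_kernel_image {X Y : C} (f : X ⟶ Y) :
    (ShortComplex.mk (kernel.ι f) (factorThruImage f)
      (by simp [← cancel_mono (image.ι f)])).ShortExact where
  exact := by
    refine ShortComplex.exact_of_f_is_kernel _ (KernelFork.IsLimit.ofι' _ _ fun {W} l hl => ?_)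
    refine ⟨kernel.lift _ l ?_, kernel.lift_ι _ _ _⟩
    rw [← image.fac f, reassoc_of% hl, zero_comp]

theorem relLength_kernel_add_image {X Y : C} (f : X ⟶ Y) :
    relLength T (kernel f) + relLength T (image f) = relLength T X :=
  (relLength_eq_add T (shortExact_kernel_image f)).symm

theorem relLength_image_le {X Y : C} (f : X ⟶ Y) : relLength T (image f) ≤ relLength T X := by
  rw [← relLength_kernel_add_image T f]
  exact le_add_self

theorem one_le_relLength {X : C} (h : ¬ T X) : 1 ≤ relLength T X := by
  have : HasLengthGE T 1 X := ⟨0, 0, inferInstance, trivial, fun h0 =>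
    h (T.prop_of_mono (cokernel.π (0 : (0 : C) ⟶ X)) h0)⟩
  exact_mod_cast (coe_le_relLength_iff T 1 X).2 this

end Length

/-! ### Lengths of images and kernels. -/

section Rank

variable {C : Type u} [Category.{v} C] [Abelian C] (T : ObjectProperty C) [T.IsSerreClass]

theorem relLength_biprod (X Y : C) : relLength T (X ⊞ Y) = relLength T X + relLength T Y :=
  relLength_eq_add T (ShortComplex.Splitting.ofHasBinaryBiproduct X Y).shortExact

theorem relLength_image_comp_le {X Y Z : C} (f : X ⟶ Y) (g : Y ⟶ Z) :
    relLength T (image (f ≫ g)) ≤ relLength T Y :=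
  (relLength_le_of_mono T (image.preComp f g)).trans (relLength_image_le T g)

theorem relLength_image_add_le {X Y : C} (f g : X ⟶ Y) :
    relLength T (image (f + g)) ≤ relLength T (image f) + relLength T (image g) := by
  rw [← relLength_biprod]
  have h : f + g = biprod.lift (factorThruImage f) (factorThruImage g) ≫
      biprod.desc (image.ι f) (image.ι g) := by
    rw [biprod.lift_desc, image.fac, image.fac]
  rw [h]
  exact relLength_image_comp_le T _ _

theorem relLength_eq_zero_of_isZero {X : C} (h : IsZero X) : relLength T X = 0 := by
  rw [relLength, ENat.iSup_eq_zero]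
  intro n
  rw [ENat.iSup_eq_zero]
  intro hn
  cases n with
  | zero => rfl
  | succ n =>
    obtain ⟨A, i, _, -, h1⟩ := hn
    exact absurd (T.prop_of_isZero (h.of_epi (cokernel.π i))) h1

theorem relLength_image_sum_le {X Y M : C} {ι : Type*} (s : Finset ι) (p : ι → (X ⟶ M))
    (q : ι → (M ⟶ Y)) :
    relLength T (image (∑ w ∈ s, p w ≫ q w)) ≤ s.card * relLength T M := by
  classical
  induction s using Finset.induction_on with
  | empty =>
    rw [Finset.sum_empty, relLength_eq_zero_of_isZero T ((isZero_zero C).of_iso imageZero)]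
    exact zero_le
  | insert a s ha ih =>
    rw [Finset.sum_insert ha, Finset.card_insert_of_notMem ha, Nat.cast_add, add_mul]
    refine (relLength_image_add_le T _ _).trans ?_
    rw [add_comm, Nat.cast_one, one_mul]
    exact add_le_add ih (relLength_image_comp_le T _ _)

/-- `f` embeds the first kernel into the second, since `g` undoes it there. -/
theorem relLength_kernel_id_sub_comp_le {X Y : C} (f : X ⟶ Y) (g : Y ⟶ X) :
    relLength T (kernel (𝟙 X - f ≫ g)) ≤ relLength T (kernel (𝟙 Y - g ≫ f)) := by
  have h : kernel.ι (𝟙 X - f ≫ g) ≫ f ≫ g = kernel.ι (𝟙 X - f ≫ g) := by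
    have := kernel.condition (𝟙 X - f ≫ g)
    rw [Preadditive.comp_sub, Category.comp_id, sub_eq_zero] at this
    exact this.symm
  let l : kernel (𝟙 X - f ≫ g) ⟶ kernel (𝟙 Y - g ≫ f) :=
    kernel.lift _ (kernel.ι (𝟙 X - f ≫ g) ≫ f) (by
      rw [Preadditive.comp_sub, Category.comp_id, Category.assoc, sub_eq_zero]
      conv_lhs => rw [← h]
      simp)
  have hl : l ≫ (kernel.ι (𝟙 Y - g ≫ f) ≫ g) = kernel.ι (𝟙 X - f ≫ g) := by
    rw [kernel.lift_ι_assoc, Category.assoc, h]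
  have : Mono l := mono_of_mono_fac hl
  exact relLength_le_of_mono T l

theorem relLength_image_id_sub_comp {X : C} (hX : relLength T X ≠ ⊤) (f g : X ⟶ X) :
    relLength T (image (𝟙 X - f ≫ g)) = relLength T (image (𝟙 X - g ≫ f)) := by
  have h1 := relLength_kernel_add_image T (𝟙 X - f ≫ g)
  have h2 := relLength_kernel_add_image T (𝟙 X - g ≫ f)
  have h3 := le_antisymm (relLength_kernel_id_sub_comp_le T f g)
    (relLength_kernel_id_sub_comp_le T g f)
  rw [← h2, ← h3] at h1
  refine ENat.add_right_injective_of_ne_top (fun htop => hX ?_) h1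
  rw [← relLength_kernel_add_image T (𝟙 X - f ≫ g), htop, top_add]

/-- For `v ≠ a`, `x v` factors through the kernel of `y a`, which allows induction. The image of `y
a` is a nonzero subobject of the torsion-free `M` and adds at least one to the length. -/
theorem card_le_relLength {M : C} (hM : ∀ {Y : C} (i : Y ⟶ M) [Mono i], T Y → i = 0)
    {ι : Type*} (s : Finset ι) {I : C} (x : ι → (M ⟶ I)) (y : ι → (I ⟶ M))
    (hne : ∀ v ∈ s, x v ≫ y v ≠ 0) (h0 : ∀ v ∈ s, ∀ w ∈ s, v ≠ w → x v ≫ y w = 0) :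
    (s.card : ℕ∞) ≤ relLength T I := by
  classical
  induction s using Finset.induction_on generalizing I with
  | empty => simp
  | insert a s ha ih =>
    rw [Finset.card_insert_of_notMem ha, Nat.cast_add, Nat.cast_one,
      ← relLength_kernel_add_image T (y a)]
    have hk (v : ι) : ∃ k : M ⟶ kernel (y a), v ∈ s → k ≫ kernel.ι (y a) = x v := by
      by_cases hv : v ∈ s
      · exact ⟨kernel.lift _ (x v) (h0 v (by simp [hv]) a (by simp) (by rintro rfl; exact ha hv)),
          fun _ => kernel.lift_ι _ _ _⟩
      · exact ⟨0, fun h => absurd h hv⟩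
    choose k hk using hk
    refine add_le_add (ih k (fun v => kernel.ι (y a) ≫ y v) ?_ ?_) (one_le_relLength T fun hT => ?_)
    · intro v hv
      rw [reassoc_of% (hk v hv)]
      exact hne v (by simp [hv])
    · intro v hv w hw hvw
      rw [reassoc_of% (hk v hv)]
      exact h0 v (by simp [hv]) w (by simp [hw]) hvw
    · refine hne a (by simp) ?_
      rw [← image.fac (y a), hM (image.ι (y a)) hT]
      simp

end Rank

/-! ### The torsion class cogenerated by an object. -/

section CogeneratedTorsion

variable {C : Type u} [Category.{v} C] [Abelian C] (N : C)

/-- The largest class of objects, closed under subobjects, for which `N` is torsion-free. -/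
def cogeneratedTorsion : ObjectProperty C :=
  fun X => ∀ ⦃Y : C⦄ (i : Y ⟶ X) [Mono i] (f : Y ⟶ N), f = 0

/-- For extensions: a morphism to `N` from a subobject `Y` of `X₂` kills the part of `Y` in `X₁`,
hence descends to the image of `Y` in `X₃`. -/
instance : (cogeneratedTorsion N).IsSerreClass where
  exists_zero := ⟨0, isZero_zero C, fun _ i _ f => (IsZero.of_mono i (isZero_zero C)).eq_of_src f 0⟩
  prop_of_mono i _ h _ j _ f := h (j ≫ i) f
  prop_of_epi p _ h _ j _ f := by
    rw [← cancel_epi (pullback.snd p j), comp_zero]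
    exact h (pullback.fst p j) _
  prop_X₂_of_shortExact {S} hS h₁ h₃ Y i _ f := by
    have := hS.mono_f
    have h0 : kernel.ι (i ≫ S.g) ≫ f = 0 := by
      have hz : (kernel.ι (i ≫ S.g) ≫ i) ≫ S.g = 0 := by simp
      have hl : hS.exact.lift (kernel.ι (i ≫ S.g) ≫ i) hz ≫ S.f =
        kernel.ι (i ≫ S.g) ≫ i := ShortComplex.Exact.lift_f _ _ _
      have : Mono (hS.exact.lift (kernel.ι (i ≫ S.g) ≫ i) hz) :=
        mono_of_mono_fac hl
      exact h₁ (hS.exact.lift (kernel.ι (i ≫ S.g) ≫ i) hz) _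
    have hex := shortExact_kernel_image (i ≫ S.g)
    have := hex.epi_g
    have hd : factorThruImage (i ≫ S.g) ≫ hex.exact.desc f h0 = f :=
      hex.exact.g_desc f h0
    rw [← hd, h₃ (image.ι (i ≫ S.g)) (hex.exact.desc f h0), comp_zero]

theorem eq_zero_of_cogeneratedTorsion {Y : C} (i : Y ⟶ N) (hY : cogeneratedTorsion N Y) : i = 0 :=
  hY (𝟙 Y) i

theorem not_cogeneratedTorsion (hN : ¬ IsZero N) : ¬ cogeneratedTorsion N N := fun h =>
  hN ((IsZero.iff_id_eq_zero N).2 (h (𝟙 N) (𝟙 N)))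

theorem mono_of_kernelSubobject_comp_le {N Q R : C} (p : N ⟶ Q) [Epi p] (q : Q ⟶ R)
    (h : kernelSubobject (p ≫ q) ≤ kernelSubobject p) : Mono q := by
  refine Preadditive.mono_of_cancel_zero _ fun {Y} j hj => ?_
  have h1 : (kernelSubobject (p ≫ q)).Factors (pullback.fst p j) :=
    kernelSubobject_factors _ _ (by rw [reassoc_of% pullback.condition (f := p) (g := j), hj,
      comp_zero])
  have h2 := (kernelSubobject_factors_iff p _).1 (Subobject.factors_of_le _ h h1)
  rw [← cancel_epi (pullback.snd p j), ← pullback.condition, h2, comp_zero]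

/-- A non-torsion quotient `Q` of `N` with maximal kernel has only torsion proper quotients, hence
length at most one. Being non-torsion, it has a subobject with a nonzero morphism to `N`. -/
theorem exists_ne_zero_of_isNoetherianObject [IsNoetherianObject N] (hN : ¬ IsZero N) :
    ∃ (Y : C) (f : Y ⟶ N), f ≠ 0 ∧ relLength (cogeneratedTorsion N) Y ≠ ⊤ := by
  obtain ⟨U, ⟨Q, p, _, rfl, hQ⟩, hmax⟩ := WellFounded.has_min (wellFounded_gt (α := Subobject N))
    {U | ∃ (Q : C) (p : N ⟶ Q) (_ : Epi p), kernelSubobject p = U ∧ ¬ cogeneratedTorsion N Q}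
    ⟨_, N, 𝟙 N, inferInstance, rfl, not_cogeneratedTorsion N hN⟩
  have hlen : relLength (cogeneratedTorsion N) Q ≤ 1 := by
    by_contra h
    have h2 : ((2 : ℕ) : ℕ∞) ≤ relLength (cogeneratedTorsion N) Q := by
      simpa [one_add_one_eq_two] using Order.add_one_le_of_lt (not_le.1 h)
    obtain ⟨A, i, _, ⟨A', j, _, -, hj⟩, hi⟩ := (coe_le_relLength_iff _ _ _).1 h2
    refine hj ((cogeneratedTorsion N).prop_of_isZero ?_)
    have hm := hmax _ ⟨_, p ≫ cokernel.π i, inferInstance, rfl, hi⟩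
    have hle : kernelSubobject p ≤ kernelSubobject (p ≫ cokernel.π i) :=
      kernelSubobject_comp_le p _
    have : Mono (cokernel.π i) := mono_of_kernelSubobject_comp_le p _
      (not_lt_iff_le_imp_ge.1 hm hle)
    have hi0 : i = 0 := by rw [← cancel_mono (cokernel.π i), cokernel.condition, zero_comp]
    have hA : IsZero A := IsZero.of_mono_eq_zero i hi0
    exact hA.of_epi (cokernel.π j)
  simp only [cogeneratedTorsion] at hQ
  push Not at hQ
  obtain ⟨Y, i, _, f, hf⟩ := hQ
  exact ⟨Y, f, hf, ne_top_of_le_ne_top (by simp) ((relLength_le_of_mono _ i).trans hlen)⟩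

/-- In a Noetherian object there is a largest subobject of finite length. -/
theorem exists_greatest_of_relLength_ne_top (T : ObjectProperty C) [T.IsSerreClass]
    [IsNoetherianObject N] :
    ∃ (M : C) (i : M ⟶ N) (_ : Mono i), relLength T M ≠ ⊤ ∧
      ∀ ⦃Y : C⦄ (f : Y ⟶ N), relLength T Y ≠ ⊤ → ∃ g : Y ⟶ M, g ≫ i = f := by
  obtain ⟨U, hU, hmax⟩ := WellFounded.has_min (wellFounded_gt (α := Subobject N))
    {U | relLength T (U : C) ≠ ⊤} ⟨⊥, by
      have h : IsZero ((⊥ : Subobject N) : C) := IsZero.of_mono_eq_zero _ Subobject.bot_arrow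
      simp [relLength_eq_zero_of_isZero T h]⟩
  refine ⟨U, U.arrow, inferInstance, hU, fun Y f hY => ?_⟩
  -- The image of `d` has finite length and contains `U`, so it equals `U` by maximality.
  let d : (U : C) ⊞ Y ⟶ N := biprod.desc U.arrow f
  have hd : relLength T (Subobject.mk (image.ι d) : C) ≠ ⊤ := by
    refine ne_top_of_le_ne_top ?_ ((relLength_le_of_mono T
      (Subobject.underlyingIso (image.ι d)).hom).trans (relLength_image_le T d))
    rw [relLength_biprod]
    exact WithTop.add_ne_top.2 ⟨hU, hY⟩
  have h1 : U ≤ Subobject.mk (image.ι d) :=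
    Subobject.le_mk_of_comm (biprod.inl ≫ factorThruImage d) (by simp [d])
  have h2 : Subobject.mk (image.ι d) ≤ U := not_lt_iff_le_imp_ge.1 (hmax _ hd) h1
  refine ⟨biprod.inr ≫ factorThruImage d ≫ Subobject.ofMkLE _ U h2, ?_⟩
  simp [d]

end CogeneratedTorsion

/-! ### Local charts of sofic approximations. -/

namespace LabeledDigraph

variable {B V W : Type*}

theorem IsPath.trans {Γ : LabeledDigraph B V} {m n : ℕ} {x y z : V} (h₁ : Γ.IsPath m x y)
    (h₂ : Γ.IsPath n y z) : Γ.IsPath (m + n) x z := by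
  induction n generalizing z with
  | zero => obtain rfl : y = z := h₂; exact h₁
  | succ n ih =>
    obtain ⟨w, hw, hwz⟩ := h₂
    exact ⟨w, ih hw, hwz⟩

theorem Adj.isPath {Γ : LabeledDigraph B V} {x y : V} (h : Γ.Adj x y) : Γ.IsPath 1 x y :=
  ⟨x, rfl, h⟩

theorem self_mem_nbhdSet (Γ : LabeledDigraph B V) (r : ℕ) (v : V) : v ∈ Γ.nbhdSet r v :=
  (Γ.mem_nbhdSet_iff r v v).2 ⟨0, by omega, rfl⟩

end LabeledDigraph

theorem cayleyDigraph_isPath_mul_left {H : Type*} [Group H] {B : Finset H} (g : H) {m : ℕ} {x y : H}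
    (h : (cayleyDigraph B).IsPath m x y) : (cayleyDigraph B).IsPath m (g * x) (g * y) := by
  induction m generalizing y with
  | zero => exact congrArg (g * ·) h
  | succ m ih =>
    obtain ⟨w, hw, hwy⟩ := h
    exact ⟨g * w, ih hw, by simpa [cayleyDigraph, mul_assoc] using hwy⟩

/-- `τ` identifies the `r`-th neighborhood of `v` with that of `1` in the Cayley graph. -/
structure IsCayleyChart {H : Type*} [Group H] {B : Finset H} {V : Type*} (Γ : LabeledDigraph B V)
    (r : ℕ) (v : V) (τ : V → H) : Prop where
  map_center : τ v = 1
  bijOn : Set.BijOn τ (Γ.nbhdSet r v) ((cayleyDigraph B).nbhdSet r 1)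
  adj_iff : ∀ x ∈ Γ.nbhdSet r v, ∀ y ∈ Γ.nbhdSet r v, Γ.Adj x y ↔ (τ x)⁻¹ * τ y ∈ B
  label_eq : ∀ x ∈ Γ.nbhdSet r v, ∀ y ∈ Γ.nbhdSet r v, ∀ h : Γ.Adj x y,
    (Γ.label h : H) = (τ x)⁻¹ * τ y

/-- An isomorphism of neighborhoods need not send `v` to `1`; left translation by `w⁻¹` corrects
this. The translate still maps into the ball around `1`, as paths from `v` go to paths from `w`, and
by finiteness it is onto. -/
theorem exists_isCayleyChart {H : Type*} [Group H] {B : Finset H} {V : Type*} [Finite V]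
    {Γ : LabeledDigraph B V} {r : ℕ} {v : V}
    (f : (Γ.nbhd r v).Iso ((cayleyDigraph B).nbhd r 1)) :
    ∃ τ : V → H, IsCayleyChart Γ r v τ := by
  classical
  have hv : v ∈ Γ.nbhdSet r v := Γ.self_mem_nbhdSet r v
  let w : H := (f.toFun ⟨v, hv⟩).1
  have hpath (m : ℕ) (hm : m ≤ r) (x : V) (hx : x ∈ Γ.nbhdSet r v) (hp : Γ.IsPath m v x) :
      (cayleyDigraph B).IsPath m w (f.toFun ⟨x, hx⟩).1 := by
    induction m generalizing x with
    | zero => obtain rfl : v = x := hp; rfl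
    | succ m ih =>
      obtain ⟨y, hy, hyx⟩ := hp
      have hy' : y ∈ Γ.nbhdSet r v := (Γ.mem_nbhdSet_iff r v y).2 ⟨m, by omega, hy⟩
      exact ⟨_, ih (by omega) y hy' hy, (f.adj_iff ⟨y, hy'⟩ ⟨x, hx⟩).1 hyx⟩
  have hmem (x : Γ.nbhdSet r v) : w⁻¹ * (f.toFun x).1 ∈ (cayleyDigraph B).nbhdSet r 1 := by
    obtain ⟨x, hx⟩ := x
    obtain ⟨m, hm, hp⟩ := (Γ.mem_nbhdSet_iff r v x).1 hx
    refine (LabeledDigraph.mem_nbhdSet_iff _ r 1 _).2 ⟨m, hm, ?_⟩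
    simpa using cayleyDigraph_isPath_mul_left w⁻¹ (hpath m hm x hx hp)
  let F : Γ.nbhdSet r v → (cayleyDigraph B).nbhdSet r 1 := fun x => ⟨_, hmem x⟩
  have hFinj : Function.Injective F := fun x y hxy => by
    have h1 : w⁻¹ * (f.toFun x).1 = w⁻¹ * (f.toFun y).1 := congrArg Subtype.val hxy
    exact f.injective (Subtype.ext (mul_left_cancel h1))
  have hFsurj : Function.Surjective F := hFinj.surjective_of_finite f.toEquiv
  let τ : V → H := fun x => if hx : x ∈ Γ.nbhdSet r v then (F ⟨x, hx⟩).1 else 1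
  have hτ (x : V) (hx : x ∈ Γ.nbhdSet r v) : τ x = w⁻¹ * (f.toFun ⟨x, hx⟩).1 := dif_pos hx
  refine ⟨τ, ?_, ⟨?_, ?_, ?_⟩, ?_, ?_⟩
  · rw [hτ v hv, inv_mul_cancel]
  · intro x hx
    rw [hτ x hx]
    exact hmem ⟨x, hx⟩
  · intro x hx y hy hxy
    rw [hτ x hx, hτ y hy] at hxy
    exact congrArg Subtype.val (hFinj (a₁ := ⟨x, hx⟩) (a₂ := ⟨y, hy⟩) (Subtype.ext hxy))
  · intro h hh
    obtain ⟨⟨x, hx⟩, hFx⟩ := hFsurj ⟨h, hh⟩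
    exact ⟨x, hx, (hτ x hx).trans (congrArg Subtype.val hFx)⟩
  · intro x hx y hy
    rw [hτ x hx, hτ y hy]
    refine (f.adj_iff ⟨x, hx⟩ ⟨y, hy⟩).trans ?_
    simp [LabeledDigraph.nbhd, LabeledDigraph.induce, cayleyDigraph, mul_assoc]
  · intro x hx y hy h
    rw [hτ x hx, hτ y hy]
    have := f.label_eq ⟨x, hx⟩ ⟨y, hy⟩ h
    have h2 := congrArg Subtype.val this
    simp only [LabeledDigraph.nbhd, LabeledDigraph.induce, cayleyDigraph] at h2
    rw [h2]
    group

theorem MonoidAlgebra.coeff_mul_eq_sum {R H : Type*} [Semiring R] [Group H] (a b : MonoidAlgebra R H)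
    (g : H) (s : Finset H) (hs : a.coeff.support ⊆ s) :
    (a * b).coeff g = ∑ h ∈ s, a.coeff h * b.coeff (h⁻¹ * g) := by
  classical
  rw [MonoidAlgebra.coeff_mul, Finsupp.sum_of_support_subset _ hs _ (by simp)]
  refine Finset.sum_congr rfl fun h _ => ?_
  rw [Finsupp.sum, Finset.sum_eq_single (h⁻¹ * g)]
  · simp
  · intro x _ hx
    rw [if_neg]
    rintro rfl
    simp at hx
  · intro hx
    simp [Finsupp.notMem_support_iff.1 hx]

open Classical in
/-- The matrix by which an element of the group ring acts on a labeled digraph. -/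
noncomputable def symbolMatrix {R H : Type*} [Semiring R] [Group H] {B : Finset H} {V : Type*}
    (Γ : LabeledDigraph B V) (a : MonoidAlgebra R H) : Matrix V V R :=
  fun x y => if h : Γ.Adj x y then a.coeff (Γ.label h) else 0

section Chart

variable {R H : Type*} [Ring R] [Group H] {B : Finset H} {V : Type*}
  {Γ : LabeledDigraph B V} {a b : MonoidAlgebra R H}

theorem adj_of_symbolMatrix_ne_zero {x y : V} (h : symbolMatrix Γ a x y ≠ 0) : Γ.Adj x y := by
  by_contra hn
  exact h (dif_neg hn)

theorem isPath_of_symbolMatrix_mul_ne_zero [Fintype V] {x y : V}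
    (h : (symbolMatrix Γ a * symbolMatrix Γ b) x y ≠ 0) : Γ.IsPath 2 x y := by
  rw [Matrix.mul_apply] at h
  obtain ⟨w, -, hw⟩ := Finset.exists_ne_zero_of_sum_ne_zero h
  exact ⟨w, (LabeledDigraph.Adj.isPath (adj_of_symbolMatrix_ne_zero (left_ne_zero_of_mul hw))),
    adj_of_symbolMatrix_ne_zero (right_ne_zero_of_mul hw)⟩

variable {r : ℕ} {v : V} {τ : V → H}

namespace IsCayleyChart

theorem symbolMatrix_apply (hτ : IsCayleyChart Γ r v τ) (ha : a.coeff.support ⊆ B) {x y : V}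
    (hx : x ∈ Γ.nbhdSet r v) (hy : y ∈ Γ.nbhdSet r v) :
    symbolMatrix Γ a x y = a.coeff ((τ x)⁻¹ * τ y) := by
  by_cases h : Γ.Adj x y
  · rw [symbolMatrix, dif_pos h, hτ.label_eq x hx y hy]
  · rw [symbolMatrix, dif_neg h]
    rw [hτ.adj_iff x hx y hy] at h
    exact (Finsupp.notMem_support_iff.1 fun h' => h (ha h')).symm

theorem symbolMatrix_mul_apply [Fintype V] (hτ : IsCayleyChart Γ r v τ) (hr : 1 ≤ r)
    (ha : a.coeff.support ⊆ B) (hb : b.coeff.support ⊆ B) {u : V} (hu : u ∈ Γ.nbhdSet r v) :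
    (symbolMatrix Γ a * symbolMatrix Γ b) v u = (a * b).coeff (τ u) := by
  classical
  have hs : a.coeff.support ⊆ (Γ.nbhdSet r v).toFinset.image τ := by
    intro h hh
    have : h ∈ (cayleyDigraph B).nbhdSet r 1 := by
      refine (LabeledDigraph.mem_nbhdSet_iff _ r 1 _).2 ⟨1, hr, LabeledDigraph.Adj.isPath ?_⟩
      simpa [cayleyDigraph] using ha hh
    obtain ⟨x, hx, rfl⟩ := hτ.bijOn.surjOn this
    exact Finset.mem_image_of_mem _ (by simpa using hx)
  rw [MonoidAlgebra.coeff_mul_eq_sum a b (τ u) _ hs, Finset.sum_image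
    (fun x hx y hy => hτ.bijOn.injOn (by simpa using hx) (by simpa using hy)), Matrix.mul_apply]
  symm
  refine Finset.sum_subset_zero_on_sdiff (Finset.subset_univ _) ?_ ?_
  · intro w hw
    have hw' : ¬ Γ.Adj v w := fun h => by
      simp only [Finset.mem_sdiff, Set.mem_toFinset] at hw
      exact hw.2 ((Γ.mem_nbhdSet_iff r v w).2 ⟨1, hr, LabeledDigraph.Adj.isPath h⟩)
    rw [symbolMatrix, dif_neg hw', zero_mul]
  · intro w hw
    have hw' : w ∈ Γ.nbhdSet r v := by simpa using hw
    rw [hτ.symbolMatrix_apply ha (Γ.self_mem_nbhdSet r v) hw', hτ.symbolMatrix_apply hb hw' hu,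
      hτ.map_center, inv_one, one_mul]

/-- `Γ` need not be symmetric, but inside a chart the symmetry of `B` reverses edges. -/
theorem isPath_reverse (hτ : IsCayleyChart Γ r v τ) (hB : ∀ b ∈ B, b⁻¹ ∈ B) {m : ℕ} (hm : m ≤ r)
    {u : V} (h : Γ.IsPath m v u) : Γ.IsPath m u v := by
  induction m generalizing u with
  | zero => exact Eq.symm h
  | succ m ih =>
    obtain ⟨x, hx, hxu⟩ := h
    have hx' : x ∈ Γ.nbhdSet r v := (Γ.mem_nbhdSet_iff r v x).2 ⟨m, by omega, hx⟩
    have hu' : u ∈ Γ.nbhdSet r v := (Γ.mem_nbhdSet_iff r v u).2 ⟨m + 1, hm, x, hx, hxu⟩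
    have hux : Γ.Adj u x := by
      rw [hτ.adj_iff u hu' x hx']
      simpa using hB _ ((hτ.adj_iff x hx' u hu').1 hxu)
    rw [add_comm]
    exact (LabeledDigraph.Adj.isPath hux).trans (ih (by omega) hx)

end IsCayleyChart

end Chart

/-- A finite set of vertices contains a subset whose elements are not in the `r`-th neighborhoods of
each other and which is large in terms of the sizes of the neighborhoods. -/
theorem LabeledDigraph.exists_separated_subset {B V : Type*} [Finite V] (Γ : LabeledDigraph B V)
    (r D : ℕ) (V₀ : Finset V) (hcard : ∀ v ∈ V₀, (Γ.nbhdSet r v).ncard ≤ D)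
    (hsymm : ∀ v ∈ V₀, ∀ w ∈ Γ.nbhdSet r v, v ∈ Γ.nbhdSet r w) :
    ∃ V₁ ⊆ V₀, V₀.card ≤ V₁.card * D ∧
      ∀ v ∈ V₁, ∀ w ∈ V₁, v ≠ w → v ∉ Γ.nbhdSet r w := by
  classical
  have := Fintype.ofFinite V
  obtain ⟨V₁, hV₁, hmax⟩ := Finset.exists_max_image
    (V₀.powerset.filter fun s => ∀ v ∈ s, ∀ w ∈ s, v ≠ w → v ∉ Γ.nbhdSet r w) Finset.card
    ⟨∅, by simp⟩
  simp only [Finset.mem_filter, Finset.mem_powerset] at hV₁ hmax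
  refine ⟨V₁, hV₁.1, ?_, hV₁.2⟩
  -- By maximality: an uncovered vertex could be added to `V₁`.
  have hcover : V₀ ⊆ V₁.biUnion fun v => (Γ.nbhdSet r v).toFinset := by
    intro x hx
    simp only [Finset.mem_biUnion, Set.mem_toFinset]
    by_contra hcon
    push Not at hcon
    have hx1 : x ∉ V₁ := fun h => hcon x h (Γ.self_mem_nbhdSet r x)
    have := hmax (insert x V₁) ⟨Finset.insert_subset hx hV₁.1, ?_⟩
    · rw [Finset.card_insert_of_notMem hx1] at this
      omega
    · intro v hv w hw hvw
      rw [Finset.mem_insert] at hv hw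
      rcases hv with rfl | hv <;> rcases hw with rfl | hw
      · exact absurd rfl hvw
      · exact hcon w hw
      · exact fun h => hcon v hv (hsymm w hx v h)
      · exact hV₁.2 v hv w hw hvw
  refine (Finset.card_le_card hcover).trans (Finset.card_biUnion_le_card_mul _ _ _ fun v hv => ?_)
  rw [← Set.ncard_eq_toFinset_card']
  exact hcard v (hV₁.1 hv)

/-! ### Direct finiteness from a rank function and soficity. -/

/-- A rank function on the square matrices over `R`, with `ℓ` the rank of the `1 × 1` matrix `1`. -/
structure MatrixRank (R : Type*) [Ring R] (ℓ : ℕ) where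
  /-- the rank of a matrix -/
  rk : ∀ {V : Type} [Fintype V] [DecidableEq V], Matrix V V R → ℕ∞
  rk_one_sub_mul_comm : ∀ {V : Type} [Fintype V] [DecidableEq V] (A B : Matrix V V R),
    rk (1 - A * B) = rk (1 - B * A)
  rk_le : ∀ {V : Type} [Fintype V] [DecidableEq V] (A : Matrix V V R) (s : Finset V),
    (∀ v ∉ s, ∀ u, A v u = 0) → rk A ≤ s.card * ℓ
  card_le_rk : ∀ {V : Type} [Fintype V] [DecidableEq V] (A : Matrix V V R) (s : Finset V)
    (c : V → V), (∀ v ∈ s, A v (c v) ≠ 0) → (∀ v ∈ s, ∀ w ∈ s, v ≠ w → A v (c w) = 0) →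
    s.card ≤ rk A

theorem MatrixRank.isDedekindFiniteMonoid_of_fg {R : Type*} [Ring R] {ℓ : ℕ} (ρ : MatrixRank R ℓ)
    {H : Type*} [Group H] [hfg : Group.FG H] (hH : IsSoficFG H) :
    IsDedekindFiniteMonoid (MonoidAlgebra R H) where
  mul_eq_one_symm {a b} hab := by
    classical
    by_contra hba
    obtain ⟨_, S, -, hS⟩ := Group.fg_iff'.1 hfg
    let B₀ : Finset H := S ∪ a.coeff.support ∪ b.coeff.support
    let B : Finset H := B₀ ∪ B₀.image (·⁻¹)
    have hB : ∀ x ∈ B, x⁻¹ ∈ B := by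
      intro x hx
      simp only [B, Finset.mem_union, Finset.mem_image] at hx ⊢
      rcases hx with hx | ⟨y, hy, rfl⟩
      · exact Or.inr ⟨x, hx, rfl⟩
      · exact Or.inl (by simpa using hy)
    have hB₀ : B₀ ⊆ B := Finset.subset_union_left
    have hSB : S ⊆ B := fun x hx => hB₀ (by simp [B₀, hx])
    have haB : a.coeff.support ⊆ B := fun x hx => hB₀ (by simp only [B₀, Finset.mem_union]; tauto)
    have hbB : b.coeff.support ⊆ B := fun x hx => hB₀ (by simp only [B₀, Finset.mem_union]; tauto)
    have hgen : Subgroup.closure (B : Set H) = ⊤ :=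
      top_le_iff.1 (hS ▸ Subgroup.closure_mono (by exact_mod_cast hSB))
    obtain ⟨g, hg⟩ : ∃ g, (1 - b * a).coeff g ≠ 0 := by
      by_contra hcon
      push Not at hcon
      exact hba (sub_eq_zero.1 (MonoidAlgebra.ext (Finsupp.ext hcon))).symm
    have hgB : g ∈ (cayleyDigraph B).nbhdSet 4 1 := by
      by_cases hg1 : g = 1
      · exact hg1 ▸ LabeledDigraph.self_mem_nbhdSet _ _ _
      · have h1 : (b * a).coeff g ≠ 0 := by
          intro h
          apply hg
          simp [MonoidAlgebra.one_def, h, Ne.symm hg1]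
        rw [MonoidAlgebra.coeff_mul_eq_sum b a g _ subset_rfl] at h1
        obtain ⟨h, -, hh⟩ := Finset.exists_ne_zero_of_sum_ne_zero h1
        refine (LabeledDigraph.mem_nbhdSet_iff _ _ _ _).2 ⟨2, by omega, h,
          LabeledDigraph.Adj.isPath ?_, ?_⟩
        · simpa [cayleyDigraph] using hbB (Finsupp.mem_support_iff.2 (left_ne_zero_of_mul hh))
        · exact haB (Finsupp.mem_support_iff.2 (right_ne_zero_of_mul hh))
    let D := ((cayleyDigraph B).nbhdSet 4 1).ncard
    -- With this `ε`, the `k` bad vertices satisfy `k * (D * ℓ + 2) ≤ |V|`, whereas the ranks will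
    -- give `|V| ≤ k * (D * ℓ + 1)`.
    obtain ⟨V, _, _, Γ, V₀, hV₀, hiso⟩ := hH B hB hgen (1 / (D * ℓ + 2)) (by positivity)
      (by rw [div_lt_one (by positivity)]; nlinarith [(Nat.cast_nonneg (D * ℓ) : (0 : ℝ) ≤ _)]) 4
    have hchart (v : V) : ∃ τ : V → H, v ∈ V₀ → IsCayleyChart Γ 4 v τ := by
      by_cases hv : v ∈ V₀
      · obtain ⟨τ, hτ⟩ := exists_isCayleyChart (hiso v hv).some
        exact ⟨τ, fun _ => hτ⟩
      · exact ⟨1, fun h => absurd h hv⟩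
    choose τ hτ using hchart
    obtain ⟨V₁, hV₁, hcard, hsep⟩ := Γ.exists_separated_subset 4 D V₀
      (fun v hv => by
        simp only [D]
        rw [← (hτ v hv).bijOn.image_eq, (hτ v hv).bijOn.injOn.ncard_image])
      (fun v hv w hw => by
        obtain ⟨m, hm, hp⟩ := (Γ.mem_nbhdSet_iff _ _ _).1 hw
        exact (Γ.mem_nbhdSet_iff _ _ _).2 ⟨m, hm, (hτ v hv).isPath_reverse hB hm hp⟩)
    have hc (v : V) : ∃ u, v ∈ V₀ → u ∈ Γ.nbhdSet 4 v ∧ τ v u = g := by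
      by_cases hv : v ∈ V₀
      · obtain ⟨u, hu⟩ := (hτ v hv).bijOn.surjOn hgB
        exact ⟨u, fun _ => hu⟩
      · exact ⟨v, fun h => absurd h hv⟩
    choose c hc using hc
    let A₁ := symbolMatrix Γ a
    let A₂ := symbolMatrix Γ b
    have hone (v : V) (hv : v ∈ V₀) (u : V) (hu : u ∈ Γ.nbhdSet 4 v) :
        (1 : Matrix V V R) v u = (1 : MonoidAlgebra R H).coeff (τ v u) := by
      rw [MonoidAlgebra.one_def, MonoidAlgebra.coeff_single, Finsupp.single_apply, Matrix.one_apply]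
      refine if_congr ?_ rfl rfl
      rw [← (hτ v hv).map_center]
      exact ⟨congrArg _, fun h => (hτ v hv).bijOn.injOn (Γ.self_mem_nbhdSet _ _) hu h⟩
    have hpath (v u : V) (h : (1 - A₂ * A₁) v u ≠ 0) : ∃ m ≤ 2, Γ.IsPath m v u := by
      by_cases hvu : v = u
      · exact ⟨0, by omega, hvu⟩
      · rw [Matrix.sub_apply, Matrix.one_apply_ne hvu, zero_sub, neg_ne_zero] at h
        exact ⟨2, le_rfl, isPath_of_symbolMatrix_mul_ne_zero h⟩
    have hcne (v : V) (hv : v ∈ V₀) : (1 - A₂ * A₁) v (c v) ≠ 0 := by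
      rw [Matrix.sub_apply, (hτ v hv).symbolMatrix_mul_apply (by omega) hbB haB (hc v hv).1,
        hone v hv _ (hc v hv).1, (hc v hv).2]
      exact hg
    have hlow : (V₁.card : ℕ∞) ≤ ρ.rk (1 - A₂ * A₁) := by
      -- If rows `v` and `w` were both nonzero in column `c w`, a path from `w` to `c w` and back to
      -- `v` would have at most `2 + 2` edges; hence the radius `4`.
      refine ρ.card_le_rk _ V₁ c (fun v hv => hcne v (hV₁ hv)) fun v hv w hw hvw => ?_
      by_contra hne
      obtain ⟨m, hm, hp⟩ := hpath _ _ hne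
      obtain ⟨n, hn, hq⟩ := hpath _ _ (hcne w (hV₁ hw))
      exact hsep v hv w hw hvw ((Γ.mem_nbhdSet_iff _ _ _).2 ⟨n + m, by omega,
        hq.trans ((hτ v (hV₁ hv)).isPath_reverse hB (by omega) hp)⟩)
    have hup : ρ.rk (1 - A₁ * A₂) ≤ (V₀ᶜ.card : ℕ∞) * ℓ := by
      refine ρ.rk_le _ _ fun v hv u => ?_
      have hv : v ∈ V₀ := by simpa using hv
      by_cases hu : u ∈ Γ.nbhdSet 4 v
      · rw [Matrix.sub_apply, (hτ v hv).symbolMatrix_mul_apply (by omega) haB hbB hu,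
          hone v hv _ hu, hab, sub_self]
      · have hvu : v ≠ u := fun h => hu (h ▸ Γ.self_mem_nbhdSet _ _)
        rw [Matrix.sub_apply, Matrix.one_apply_ne hvu, zero_sub, neg_eq_zero]
        by_contra hne
        exact hu ((Γ.mem_nbhdSet_iff _ _ _).2
          ⟨2, by omega, isPath_of_symbolMatrix_mul_ne_zero hne⟩)
    have h1 : V₁.card ≤ V₀ᶜ.card * ℓ := by
      rw [ρ.rk_one_sub_mul_comm] at hup
      exact_mod_cast hlow.trans hup
    rw [Finset.card_compl] at h1
    have h2 : V₀.card + (Fintype.card V - V₀.card) = Fintype.card V :=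
      Nat.add_sub_cancel' (Finset.card_le_univ _)
    have h3 : 0 < Fintype.card V := Fintype.card_pos
    set k := Fintype.card V - V₀.card
    have h4 : V₀.card ≤ k * ℓ * D := hcard.trans (Nat.mul_le_mul_right _ h1)
    have h5 : (V₀.card : ℝ) ≤ k * ℓ * D := by exact_mod_cast h4
    have h6 : (V₀.card : ℝ) + k = Fintype.card V := by exact_mod_cast h2
    have h7 : (0 : ℝ) < Fintype.card V := by exact_mod_cast h3
    have h8 : (k : ℝ) * (D * ℓ + 2) ≤ Fintype.card V := by
      have : (k : ℝ) ≤ 1 / (D * ℓ + 2) * Fintype.card V := by linarith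
      rw [one_div, inv_mul_eq_div, le_div_iff₀ (by positivity)] at this
      exact this
    have h9 : (0 : ℝ) ≤ k := Nat.cast_nonneg k
    have h10 : (k : ℝ) = 0 := by nlinarith
    rw [h10] at h5 h6
    nlinarith

theorem MonoidAlgebra.mem_range_mapDomainRingHom_subtype {R G : Type*} [Semiring R] [Group G]
    (H : Subgroup G) (a : MonoidAlgebra R G) (ha : (a.coeff.support : Set G) ⊆ H) :
    ∃ a' : MonoidAlgebra R H, MonoidAlgebra.mapDomainRingHom R H.subtype a' = a := by
  refine ⟨MonoidAlgebra.comapDomain H.subtype H.subtype_injective a, ?_⟩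
  refine MonoidAlgebra.ext ?_
  simp only [MonoidAlgebra.mapDomainRingHom_apply, MonoidAlgebra.coeff_mapDomain,
    MonoidAlgebra.coeff_comapDomain]
  exact Finsupp.mapDomain_comapDomain _ H.subtype_injective _ (by simpa using ha)

theorem MatrixRank.isDedekindFiniteMonoid {R : Type*} [Ring R] {ℓ : ℕ} (ρ : MatrixRank R ℓ)
    {G : Type*} [Group G] (hG : IsSofic G) : IsDedekindFiniteMonoid (MonoidAlgebra R G) where
  mul_eq_one_symm {a b} hab := by
    classical
    let S : Finset G := a.coeff.support ∪ b.coeff.support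
    let H : Subgroup G := Subgroup.closure (S : Set G)
    have hHfg : H.FG := ⟨S, rfl⟩
    have : Group.FG H := (Group.fg_iff_subgroup_fg H).2 hHfg
    obtain ⟨a', ha'⟩ := MonoidAlgebra.mem_range_mapDomainRingHom_subtype H a
      (fun x hx => Subgroup.subset_closure (by simp only [S, Finset.coe_union]; exact Or.inl hx))
    obtain ⟨b', hb'⟩ := MonoidAlgebra.mem_range_mapDomainRingHom_subtype H b
      (fun x hx => Subgroup.subset_closure (by simp only [S, Finset.coe_union]; exact Or.inr hx))
    have := ρ.isDedekindFiniteMonoid_of_fg (hG H hHfg)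
    have hinj : Function.Injective (MonoidAlgebra.mapDomainRingHom R H.subtype) :=
      MonoidAlgebra.mapDomain_injective H.subtype_injective
    rw [← ha', ← hb', ← map_mul,
      mul_eq_one_symm (hinj (by rw [map_mul, ha', hb', hab, map_one])), map_one]

/-- All coefficients of the idempotent `1 - b * a` are killed by both `f₁` and `f₂`, so its square
vanishes. -/
theorem MonoidAlgebra.isDedekindFiniteMonoid_of_ringHom {R R₁ R₂ G : Type*} [Ring R] [Ring R₁]
    [Ring R₂] [Group G] (f₁ : R →+* R₁) (f₂ : R →+* R₂)
    (h : ∀ x y, f₁ x = 0 → f₂ y = 0 → x * y = 0) [IsDedekindFiniteMonoid (MonoidAlgebra R₁ G)]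
    [IsDedekindFiniteMonoid (MonoidAlgebra R₂ G)] :
    IsDedekindFiniteMonoid (MonoidAlgebra R G) where
  mul_eq_one_symm {a b} hab := by
    let e := 1 - b * a
    have h₁ : MonoidAlgebra.mapRingHom G f₁ e = 0 := by
      rw [map_sub, map_mul, mul_eq_one_symm (by rw [← map_mul, hab, map_one]), map_one, sub_self]
    have h₂ : MonoidAlgebra.mapRingHom G f₂ e = 0 := by
      rw [map_sub, map_mul, mul_eq_one_symm (by rw [← map_mul, hab, map_one]), map_one, sub_self]
    have h₁' (g : G) : f₁ (e.coeff g) = 0 := by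
      simpa using congrArg (fun x => MonoidAlgebra.coeff x g) h₁
    have h₂' (g : G) : f₂ (e.coeff g) = 0 := by
      simpa using congrArg (fun x => MonoidAlgebra.coeff x g) h₂
    have hee : e * e = 0 := by
      refine MonoidAlgebra.ext (Finsupp.ext fun g => ?_)
      rw [MonoidAlgebra.coeff_mul_eq_sum e e g _ subset_rfl]
      exact Finset.sum_eq_zero fun x _ => h _ _ (h₁' _) (h₂' _)
    have he : e * e = e := by
      have : b * a * (b * a) = b * a := by rw [mul_assoc, ← mul_assoc a, hab, one_mul]
      simp only [e, mul_sub, sub_mul, mul_one, one_mul, this, sub_self, sub_zero]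
    exact (sub_eq_zero.1 (he.symm.trans hee)).symm

/-! ### Matrices over an endomorphism ring; restriction and quotient maps. -/

section EndRank

variable {C : Type u} [Category.{v} C] [Abelian C]

section

variable [HasFiniteBiproducts C]

/-- The endomorphism of a power of `M` given by a matrix over the endomorphism ring of `M`. -/
noncomputable def matrixEnd {M : C} {V : Type} [Fintype V] [DecidableEq V]
    (A : Matrix V V (End M)) : (⨁ fun _ : V => M) ⟶ ⨁ fun _ : V => M :=
  biproduct.matrix fun w v => A v w

theorem matrixEnd_components {M : C} {V : Type} [Fintype V] [DecidableEq V]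
    (A : Matrix V V (End M)) (v w : V) :
    biproduct.ι (fun _ : V => M) w ≫ matrixEnd A ≫ biproduct.π (fun _ : V => M) v = A v w := by
  simp [matrixEnd]

/-- The order is reversed because the product in `End` is `f * g = g ≫ f`. -/
theorem matrixEnd_one_sub_mul {M : C} {V : Type} [Fintype V] [DecidableEq V]
    (A B : Matrix V V (End M)) : matrixEnd (1 - A * B) = 𝟙 _ - matrixEnd B ≫ matrixEnd A := by
  refine biproduct.hom_ext' _ _ fun w => biproduct.hom_ext _ _ fun v => ?_
  have h : matrixEnd B ≫ matrixEnd A = ∑ x : V, (matrixEnd B ≫ biproduct.π (fun _ : V => M) x) ≫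
      biproduct.ι (fun _ : V => M) x ≫ matrixEnd A := by
    conv_lhs => rw [← Category.id_comp (matrixEnd A), ← biproduct.total, Preadditive.sum_comp,
      Preadditive.comp_sum]
    simp only [Category.assoc]
  rw [Category.assoc, matrixEnd_components, Category.assoc, Preadditive.sub_comp,
    Preadditive.comp_sub, h, Preadditive.sum_comp, Preadditive.comp_sum]
  refine (Matrix.sub_apply _ _ _ _).trans ?_
  rw [Matrix.mul_apply]
  refine congrArg₂ (fun x y : M ⟶ M => x - y) ?_ ?_
  · rw [Category.id_comp, Matrix.one_apply, biproduct.ι_π]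
    by_cases hvw : v = w
    · subst hvw; simp
    · simp [hvw, Ne.symm hvw]
  · refine Finset.sum_congr rfl fun x _ => ?_
    have h1 := matrixEnd_components A v x
    have h2 := matrixEnd_components B x w
    rw [End.mul_def, ← h1, ← h2]
    simp only [Category.assoc]

theorem relLength_biproduct_ne_top (T : ObjectProperty C) [T.IsSerreClass] {M : C}
    (hM : relLength T M ≠ ⊤) (V : Type) [Fintype V] : relLength T (⨁ fun _ : V => M) ≠ ⊤ := by
  classical
  have h := relLength_image_sum_le T Finset.univ (biproduct.π fun _ : V => M)
    (biproduct.ι fun _ : V => M)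
  rw [biproduct.total] at h
  have : Mono (factorThruImage (𝟙 (⨁ fun _ : V => M))) := mono_of_mono_fac (image.fac _)
  refine ne_top_of_le_ne_top ?_ ((relLength_le_of_mono T (factorThruImage (𝟙 _))).trans h)
  exact WithTop.mul_ne_top (ENat.natCast_ne_top _) hM

/-- The rank function on the matrices over the endomorphism ring of an object of finite length. -/
noncomputable def endMatrixRank (T : ObjectProperty C) [T.IsSerreClass] {M : C} {ℓ : ℕ}
    (hℓ : relLength T M = ℓ) (hM : ∀ {Y : C} (i : Y ⟶ M) [Mono i], T Y → i = 0) :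
    MatrixRank (End M) ℓ where
  rk A := relLength T (image (matrixEnd A))
  rk_one_sub_mul_comm {V _ _} A B := by
    rw [matrixEnd_one_sub_mul, matrixEnd_one_sub_mul]
    exact relLength_image_id_sub_comp T (relLength_biproduct_ne_top T (by simp [hℓ]) V) _ _
  rk_le {V _ _} A s hs := by
    have h : matrixEnd A = ∑ v ∈ s, (matrixEnd A ≫ biproduct.π (fun _ : V => M) v) ≫
        biproduct.ι (fun _ : V => M) v := by
      conv_lhs => rw [← Category.comp_id (matrixEnd A), ← biproduct.total, Preadditive.comp_sum]
      symm
      simp only [Category.assoc]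
      refine Finset.sum_subset (Finset.subset_univ s) fun v _ hv => ?_
      have h0 : matrixEnd A ≫ biproduct.π (fun _ : V => M) v = 0 :=
        biproduct.hom_ext' _ _ fun w => by
          rw [matrixEnd_components, hs v hv w, comp_zero]
      rw [reassoc_of% h0, zero_comp]
    rw [h, ← hℓ]
    exact relLength_image_sum_le T s _ _
  card_le_rk {V _ _} A s c hne h0 := by
    have h (v w : V) : (biproduct.ι (fun _ : V => M) (c v) ≫ factorThruImage (matrixEnd A)) ≫
        (image.ι (matrixEnd A) ≫ biproduct.π (fun _ : V => M) w) = A w (c v) := by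
      rw [Category.assoc, image.fac_assoc, matrixEnd_components]
    refine card_le_relLength T hM s
      (fun v => biproduct.ι (fun _ : V => M) (c v) ≫ factorThruImage (matrixEnd A))
      (fun v => image.ι (matrixEnd A) ≫ biproduct.π (fun _ : V => M) v) ?_ ?_
    · intro v hv
      rw [h]
      exact hne v hv
    · intro v hv w hw hvw
      rw [h]
      exact h0 w hw v hv hvw.symm

end

/-- The restriction of endomorphisms to an invariant subobject. -/
noncomputable def endRestrict {M Q : C} (i : M ⟶ Q) [Mono i]
    (h : ∀ f : Q ⟶ Q, ∃ g : M ⟶ M, g ≫ i = i ≫ f) : End Q →+* End M where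
  toFun f := (h f).choose
  map_one' := by
    rw [← cancel_mono i, (h _).choose_spec]
    simp [End.one_def]
  map_mul' f g := by
    rw [← cancel_mono i, (h _).choose_spec, End.mul_def, End.mul_def, Category.assoc,
      (h f).choose_spec, ← Category.assoc, ← Category.assoc, (h g).choose_spec]
  map_zero' := by
    rw [← cancel_mono i, (h _).choose_spec]
    simp
  map_add' f g := by
    rw [← cancel_mono i, (h _).choose_spec, Preadditive.add_comp, Preadditive.comp_add,
      (h f).choose_spec, (h g).choose_spec]

theorem endRestrict_comp {M Q : C} (i : M ⟶ Q) [Mono i]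
    (h : ∀ f : Q ⟶ Q, ∃ g : M ⟶ M, g ≫ i = i ≫ f) (f : End Q) :
    (endRestrict i h f : M ⟶ M) ≫ i = i ≫ f := (h f).choose_spec

/-- The endomorphisms induced on the quotient by an invariant subobject. -/
noncomputable def endCokernel {M Q : C} (i : M ⟶ Q)
    (h : ∀ f : Q ⟶ Q, ∃ g : M ⟶ M, g ≫ i = i ≫ f) : End Q →+* End (cokernel i) where
  toFun f := cokernel.desc i ((f : Q ⟶ Q) ≫ cokernel.π i) (by
    obtain ⟨g, hg⟩ := h f
    rw [← reassoc_of% hg, cokernel.condition, comp_zero])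
  map_one' := by
    rw [← cancel_epi (cokernel.π i), cokernel.π_desc]
    simp [End.one_def]
  map_mul' f g := by
    rw [← cancel_epi (cokernel.π i), cokernel.π_desc]
    simp [End.mul_def]
  map_zero' := by
    rw [← cancel_epi (cokernel.π i), cokernel.π_desc]
    simp
  map_add' f g := by
    rw [← cancel_epi (cokernel.π i), cokernel.π_desc, Preadditive.comp_add]
    simp only [cokernel.π_desc]
    exact Preadditive.add_comp _ _ _ _ _ _

theorem π_comp_endCokernel {M Q : C} (i : M ⟶ Q)
    (h : ∀ f : Q ⟶ Q, ∃ g : M ⟶ M, g ≫ i = i ≫ f) (f : End Q) :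
    cokernel.π i ≫ (endCokernel i h f : cokernel i ⟶ cokernel i) = (f : Q ⟶ Q) ≫ cokernel.π i :=
  cokernel.π_desc _ _ _

end EndRank

/-! ### Noetherian induction over quotients. -/

section Quotient

variable {C : Type u} [Category.{v} C] [Abelian C]

/-- Strict chains lift to `N`: the kernel of `N ⟶ Q/S` determines `S`. -/
theorem isNoetherianObject_of_epi {N Q : C} (p : N ⟶ Q) [Epi p] [IsNoetherianObject N] :
    IsNoetherianObject Q := by
  rw [isNoetherianObject_iff_not_strictMono]
  intro f hf
  have key {S S' : Subobject Q} (h : S < S') :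
      kernelSubobject (p ≫ cokernel.π S.arrow) < kernelSubobject (p ≫ cokernel.π S'.arrow) := by
    let q : cokernel S.arrow ⟶ cokernel S'.arrow := cokernel.desc _ (cokernel.π S'.arrow)
      (by rw [← Subobject.ofLE_arrow h.le, Category.assoc, cokernel.condition, comp_zero])
    have hq : p ≫ cokernel.π S'.arrow = (p ≫ cokernel.π S.arrow) ≫ q := by
      rw [Category.assoc, cokernel.π_desc]
    rw [hq]
    refine lt_of_le_not_ge (kernelSubobject_comp_le _ _) fun hle => h.not_ge ?_
    have := mono_of_kernelSubobject_comp_le _ q hle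
    have h0 : S'.arrow ≫ cokernel.π S.arrow = 0 := by
      rw [← cancel_mono q, Category.assoc, cokernel.π_desc, cokernel.condition, zero_comp]
    exact Subobject.le_of_comm (Abelian.monoLift S.arrow S'.arrow h0)
      (Abelian.monoLift_comp S.arrow S'.arrow h0)
  exact not_strictMono_of_isNoetherianObject
    (fun n => kernelSubobject (p ≫ cokernel.π (f n).arrow)) fun m n hmn => key (hf hmn)

theorem isDedekindFiniteMonoid_monoidAlgebra_end_of_isZero {Q : C} (hQ : IsZero Q) (G : Type*)
    [Group G] : IsDedekindFiniteMonoid (MonoidAlgebra (End Q) G) where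
  mul_eq_one_symm {a b} _ := by
    have : Subsingleton (End Q) := ⟨fun f g => hQ.eq_of_src f g⟩
    exact MonoidAlgebra.ext (Finsupp.ext fun g => Subsingleton.elim _ _)

/-- The group ring of a sofic group over the endomorphism ring of a Noetherian object is directly
finite. -/
theorem isDedekindFiniteMonoid_monoidAlgebra_end {G : Type*} [Group G] (hG : IsSofic G) (N : C)
    [IsNoetherianObject N] : IsDedekindFiniteMonoid (MonoidAlgebra (End N) G) := by
  have key (U : Subobject N) : ∀ {Q : C} (p : N ⟶ Q) [Epi p], kernelSubobject p = U →
      IsDedekindFiniteMonoid (MonoidAlgebra (End Q) G) := by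
    induction U using WellFoundedGT.induction with | ind U ih => ?_
    intro Q p _ hp
    by_cases hQ : IsZero Q
    · exact isDedekindFiniteMonoid_monoidAlgebra_end_of_isZero hQ G
    have := isNoetherianObject_of_epi p
    obtain ⟨Y, f, hf, hY⟩ := exists_ne_zero_of_isNoetherianObject Q hQ
    obtain ⟨M, i, _, hM, hfac⟩ := exists_greatest_of_relLength_ne_top Q (cogeneratedTorsion Q)
    have hi : i ≠ 0 := by
      rintro rfl
      obtain ⟨g, rfl⟩ := hfac f hY
      simp at hf
    -- Full invariance: `i ≫ f` has a source of finite length, so it factors through `M`.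
    have hinv (f : Q ⟶ Q) : ∃ g : M ⟶ M, g ≫ i = i ≫ f := hfac (i ≫ f) hM
    obtain ⟨ℓ, hℓ⟩ := ENat.ne_top_iff_exists.1 hM
    have h₁ : IsDedekindFiniteMonoid (MonoidAlgebra (End M) G) :=
      have := Abelian.hasFiniteBiproducts (C := C)
      (endMatrixRank (cogeneratedTorsion Q) hℓ.symm fun j _ hj => by
        rw [← cancel_mono i, zero_comp]
        exact eq_zero_of_cogeneratedTorsion Q (j ≫ i) hj).isDedekindFiniteMonoid hG
    have h₂ : IsDedekindFiniteMonoid (MonoidAlgebra (End (cokernel i)) G) := by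
      refine ih _ ?_ (p ≫ cokernel.π i) rfl
      rw [← hp]
      refine lt_of_le_not_ge (kernelSubobject_comp_le _ _) fun hle => hi ?_
      have := mono_of_kernelSubobject_comp_le p _ hle
      rw [← cancel_mono (cokernel.π i), cokernel.condition, zero_comp]
    refine MonoidAlgebra.isDedekindFiniteMonoid_of_ringHom (endRestrict i hinv)
      (endCokernel i hinv) fun x y hx hy => ?_
    have hx' : i ≫ (x : Q ⟶ Q) = 0 := by
      rw [← endRestrict_comp i hinv x, hx]
      exact zero_comp
    have hy' : (y : Q ⟶ Q) ≫ cokernel.π i = 0 := by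
      rw [← π_comp_endCokernel i hinv y, hy]
      exact comp_zero
    -- `x * y` applies `y` first, which lands in `M`, where `x` vanishes.
    rw [End.mul_def, ← Abelian.monoLift_comp i y hy', Category.assoc, hx', comp_zero]
  exact key _ (𝟙 N) rfl

end Quotient

theorem MonoidAlgebra.coeff_mul_eq_sum_right {R H : Type*} [Semiring R] [Group H]
    (a b : MonoidAlgebra R H) (g : H) (s : Finset H) (hs : b.coeff.support ⊆ s) :
    (a * b).coeff g = ∑ h ∈ s, a.coeff (g * h⁻¹) * b.coeff h := by
  classical
  rw [MonoidAlgebra.coeff_mul_eq_sum a b g (a.coeff.support ∪ s.image (fun h => g * h⁻¹))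
    Finset.subset_union_left]
  symm
  rw [← Finset.sum_subset (Finset.subset_union_right (s₁ := a.coeff.support))]
  · rw [Finset.sum_image (by intro x _ y _ h; simpa using h)]
    simp
  · intro x _ hx
    have : g⁻¹ * x ∉ s.image (·⁻¹) := by
      intro h
      obtain ⟨y, hy, hyx⟩ := Finset.mem_image.1 h
      exact hx (Finset.mem_image.2 ⟨y, hy, by simp [hyx]⟩)
    have : x⁻¹ * g ∉ b.coeff.support := fun h => this
      (Finset.mem_image.2 ⟨x⁻¹ * g, hs h, by simp⟩)
    rw [Finsupp.notMem_support_iff.1 this, mul_zero]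

/-! ### From the induced representation to the group ring. -/

section Finiteness

open IsGrothendieckAbelian.IsPresentable

variable {C : Type u} [Category.{v} C] [Abelian C] [IsGrothendieckAbelian.{v} C]

/-- A morphism from a Noetherian object to a filtered colimit of monomorphisms factors through one
of the objects of the diagram. -/
theorem exists_factorization_of_isNoetherianObject {N : C} [IsNoetherianObject N] {J : Type v}
    [SmallCategory J] [IsFiltered J] {Y : J ⥤ C} {c : Cocone Y} (hc : IsColimit c)
    [∀ (j j' : J) (φ : j ⟶ j'), Mono (Y.map φ)] (z : N ⟶ c.pt) :
    ∃ (j : J) (y : N ⟶ Y.obj j), z = y ≫ c.ι.app j := by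
  have := IsFiltered.isConnected J
  have := hc.mono_ι_app_of_isFiltered
  have := NatTrans.mono_of_mono_app c.ι
  -- These are the preimages under `z` of the terms of the diagram. Exactness of filtered colimits
  -- makes their supremum `N`; the chain condition makes one of them `N`.
  let s (j : J) : Subobject N := Subobject.mk ((surjectivity.F z).obj j).obj.hom
  have hsup : ⨆ j, s j = ⊤ := by
    have hepi := surjectivity.epi_f hc z
    have := IsGrothendieckAbelian.mono_of_isColimit_monoOver (surjectivity.F z)
      (colimit.isColimit _) (surjectivity.f z) (surjectivity.hf z)
    rw [← IsGrothendieckAbelian.subobjectMk_of_isColimit_eq_iSup (surjectivity.F z)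
      (colimit.isColimit _) (surjectivity.f z) (surjectivity.hf z)]
    exact (Subobject.epi_iff_mk_eq_top _).1 hepi
  obtain ⟨j, hj⟩ : ∃ j, s j = ⊤ := by
    obtain ⟨_, ⟨j, rfl⟩, hmax⟩ := WellFounded.has_min (wellFounded_gt (α := Subobject N))
      (Set.range s) ⟨_, IsFiltered.nonempty.some, rfl⟩
    refine ⟨j, top_le_iff.1 (hsup ▸ iSup_le fun k => ?_)⟩
    have h1 : s j ≤ s (IsFiltered.max j k) := MonoOver.subobjectMk_le_mk_of_hom
      ((surjectivity.F z).map (IsFiltered.leftToMax j k))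
    have h2 : s k ≤ s (IsFiltered.max j k) := MonoOver.subobjectMk_le_mk_of_hom
      ((surjectivity.F z).map (IsFiltered.rightToMax j k))
    exact h2.trans (not_lt_iff_le_imp_ge.1 (hmax _ ⟨_, rfl⟩) h1)
  let p : (pullback c.ι ((Functor.const J).map z)).obj j ⟶ N :=
    (pullback.snd c.ι ((Functor.const J).map z)).app j
  have : IsIso p := (Subobject.isIso_iff_mk_eq_top _).2 hj
  refine ⟨j, inv p ≫ (pullback.fst c.ι ((Functor.const J).map z)).app j, ?_⟩
  rw [Category.assoc, IsIso.eq_inv_comp]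
  exact (NatTrans.congr_app (pullback.condition (f := c.ι) (g := (Functor.const J).map z)) j).symm

end Finiteness

section InducedRep

open CoproductsFromFiniteFiltered

variable {C : Type u} [Category.{v} C] [Abelian C] [IsGrothendieckAbelian.{v} C]
  {G : Type v} [Group G] {N : C}

open Classical in
/-- The projection of the representation induced by `N` to the copy of index `g`. -/
noncomputable def inducedRepπ (N : C) (g : G) : (inducedRep G N).V ⟶ N :=
  inducedRepDesc G N fun h => if h = g then 𝟙 N else 0

theorem inducedRepι_π_self (N : C) (g : G) : inducedRepι G N g ≫ inducedRepπ N g = 𝟙 N := by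
  simp [inducedRepπ]

theorem inducedRepι_π_of_ne (N : C) {g h : G} (hgh : g ≠ h) :
    inducedRepι G N g ≫ inducedRepπ N h = 0 := by
  simp [inducedRepπ, hgh]

theorem inducedRep_ρ_π (N : C) (g h : G) :
    (inducedRep G N).ρ g ≫ inducedRepπ N h = inducedRepπ N (g⁻¹ * h) := by
  refine inducedRep_hom_ext G N fun k => ?_
  rw [← Category.assoc, inducedRepι_ρ]
  by_cases hk : k = g⁻¹ * h
  · subst hk
    rw [inducedRepι_π_self, mul_inv_cancel_left, inducedRepι_π_self]
  · rw [inducedRepι_π_of_ne N hk, inducedRepι_π_of_ne N fun h' => hk (by simp [← h'])]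

theorem mono_sigmaDesc_of_subset {ι : Type v} {S T : Finset ι} (h : S ⊆ T) (N : C) :
    Mono (Sigma.desc fun x : S => Sigma.ι (fun _ : T => N) ⟨x.1, h x.2⟩) := by
  classical
  let r : (∐ fun _ : T => N) ⟶ ∐ fun _ : S => N := Sigma.desc fun x =>
    if hx : x.1 ∈ S then Sigma.ι (fun _ : S => N) ⟨x.1, hx⟩ else 0
  have hr : (Sigma.desc fun x : S => Sigma.ι (fun _ : T => N) ⟨x.1, h x.2⟩) ≫ r = 𝟙 _ :=
    Sigma.hom_ext _ _ fun x => by simp [r]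
  exact mono_of_mono_fac hr

/-- The coproduct is the filtered colimit of its finite subcoproducts along monomorphisms, so `f`
factors through one of them. -/
theorem exists_eq_sum_inducedRepι [IsNoetherianObject N] (f : N ⟶ (inducedRep G N).V) :
    ∃ s : Finset G, f = ∑ g ∈ s, (f ≫ inducedRepπ N g) ≫ inducedRepι G N g := by
  classical
  have hmono (S T : Finset (Discrete G)) (φ : S ⟶ T) :
      Mono ((liftToFinsetObj (Discrete.functor fun _ : G => N)).map φ) :=
    mono_sigmaDesc_of_subset (leOfHom φ) N
  obtain ⟨S, y, hy⟩ := exists_factorization_of_isNoetherianObject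
    (isColimitFiniteSubproductsCocone fun _ : G => N) f
  let d : (∐ fun _ : S => N) ⟶ (inducedRep G N).V := Sigma.desc fun x => inducedRepι G N x.1.as
  let y' : N ⟶ ∐ fun _ : S => N := y
  have hy' : f = y' ≫ d := hy
  refine ⟨S.image Discrete.as, ?_⟩
  have hS : d ≫ (∑ g ∈ S.image Discrete.as, inducedRepπ N g ≫ inducedRepι G N g) = d := by
    refine Sigma.hom_ext _ _ fun x => ?_
    have hx : Sigma.ι (fun _ : S => N) x ≫ d = inducedRepι G N x.1.as := Sigma.ι_desc _ _
    rw [← Category.assoc, hx, Preadditive.comp_sum, Finset.sum_eq_single x.1.as]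
    · rw [← Category.assoc, inducedRepι_π_self, Category.id_comp]
    · intro g _ hg
      rw [← Category.assoc, inducedRepι_π_of_ne N hg.symm, zero_comp]
    · intro h
      exact absurd (Finset.mem_image_of_mem _ x.2) h
  simp only [Category.assoc]
  rw [← Preadditive.comp_sum]
  conv_lhs => rw [hy', ← hS, ← Category.assoc, ← hy']

theorem inducedRepι_comp_hom {A : Action C G} (φ : inducedRep G N ⟶ A) (g : G) :
    inducedRepι G N g ≫ φ.hom = inducedRepι G N 1 ≫ φ.hom ≫ A.ρ g := by
  rw [← φ.comm, ← Category.assoc, inducedRepι_ρ, mul_one]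

theorem comp_inducedRepπ_eq_zero {f : N ⟶ (inducedRep G N).V} {s : Finset G}
    (hs : f = ∑ g ∈ s, (f ≫ inducedRepπ N g) ≫ inducedRepι G N g) {g : G} (hg : g ∉ s) :
    f ≫ inducedRepπ N g = 0 := by
  rw [hs, Preadditive.sum_comp]
  refine Finset.sum_eq_zero fun h hh => ?_
  rw [Category.assoc, inducedRepι_π_of_ne N (by rintro rfl; exact hg hh), comp_zero]

variable (G N) in
/-- The endomorphisms of the representation induced by a Noetherian object, as elements of the
group ring over its endomorphism ring. -/
noncomputable def inducedRepEndHom [IsNoetherianObject N] :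
    End (inducedRep G N) →* MonoidAlgebra (End N) G where
  -- The coefficient at `g` is the component at `g⁻¹`: without the inverse, composition would
  -- multiply group elements in the opposite order.
  toFun φ := MonoidAlgebra.ofCoeff (Finsupp.ofSupportFinite
    (fun g => (inducedRepι G N 1 ≫ φ.hom ≫ inducedRepπ N g⁻¹ : N ⟶ N)) (by
      classical
      obtain ⟨s, hs⟩ := exists_eq_sum_inducedRepι (inducedRepι G N 1 ≫ φ.hom)
      refine (s.image (·⁻¹)).finite_toSet.subset fun g hg => ?_
      by_contra hn
      refine hg ((Category.assoc _ _ _).symm.trans (comp_inducedRepπ_eq_zero hs fun h => hn ?_))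
      exact Finset.mem_coe.2 (Finset.mem_image.2 ⟨_, h, inv_inv g⟩)))
  map_one' := by
    classical
    refine MonoidAlgebra.ext (Finsupp.ext fun g => ?_)
    rw [MonoidAlgebra.one_def, MonoidAlgebra.coeff_single, Finsupp.single_apply]
    change inducedRepι G N 1 ≫ 𝟙 _ ≫ inducedRepπ N g⁻¹ = _
    rw [Category.id_comp]
    split_ifs with h
    · rw [← h, inv_one, inducedRepι_π_self]
      rfl
    · exact inducedRepι_π_of_ne N fun h' => h (by rw [← inv_inv g, ← h', inv_one])
  map_mul' φ ψ := by
    classical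
    refine MonoidAlgebra.ext (Finsupp.ext fun k => ?_)
    obtain ⟨s, hs⟩ := exists_eq_sum_inducedRepι (inducedRepι G N 1 ≫ ψ.hom)
    rw [MonoidAlgebra.coeff_mul_eq_sum_right _ _ k (s.image (·⁻¹)), Finset.sum_image
      (fun x _ y _ h => inv_injective h)]
    · change inducedRepι G N 1 ≫ (ψ.hom ≫ φ.hom) ≫ inducedRepπ N k⁻¹ = ∑ g ∈ s,
        (inducedRepι G N 1 ≫ ψ.hom ≫ inducedRepπ N g⁻¹⁻¹) ≫
          (inducedRepι G N 1 ≫ φ.hom ≫ inducedRepπ N (k * g⁻¹⁻¹)⁻¹)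
      rw [Category.assoc, ← Category.assoc, hs, Preadditive.sum_comp]
      refine Finset.sum_congr rfl fun g _ => ?_
      rw [inv_inv, mul_inv_rev, ← inducedRep_ρ_π]
      simp only [Category.assoc]
      congr 3
      rw [← Category.assoc, inducedRepι_comp_hom]
      simp only [Category.assoc]
    · intro g hg
      by_contra hn
      refine Finsupp.mem_support_iff.1 hg ((Category.assoc _ _ _).symm.trans
        (comp_inducedRepπ_eq_zero hs fun h => hn ?_))
      exact Finset.mem_image.2 ⟨_, h, inv_inv g⟩

theorem inducedRepEndHom_injective [IsNoetherianObject N] :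
    Function.Injective (inducedRepEndHom G N) := by
  intro φ ψ h
  refine (inducedRepHomEquiv G N (inducedRep G N)).injective ?_
  change inducedRepι G N 1 ≫ φ.hom = inducedRepι G N 1 ≫ ψ.hom
  have hc (g : G) : (inducedRepι G N 1 ≫ φ.hom) ≫ inducedRepπ N g =
      (inducedRepι G N 1 ≫ ψ.hom) ≫ inducedRepπ N g := by
    have h1 : inducedRepι G N 1 ≫ φ.hom ≫ inducedRepπ N g⁻¹⁻¹ =
        inducedRepι G N 1 ≫ ψ.hom ≫ inducedRepπ N g⁻¹⁻¹ :=
      congrArg (fun x => MonoidAlgebra.coeff x g⁻¹) h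
    rw [inv_inv] at h1
    rw [Category.assoc, Category.assoc, h1]
  have h0 : inducedRepι G N 1 ≫ φ.hom - inducedRepι G N 1 ≫ ψ.hom = 0 := by
    obtain ⟨s, hs⟩ := exists_eq_sum_inducedRepι
      (inducedRepι G N 1 ≫ φ.hom - inducedRepι G N 1 ≫ ψ.hom)
    rw [hs]
    refine Finset.sum_eq_zero fun g _ => ?_
    rw [Preadditive.sub_comp, hc g, sub_self, zero_comp]
  exact sub_eq_zero.1 h0

end InducedRep

theorem mainTheorem5 {C : Type u} [Category.{v} C] [Abelian C] [IsGrothendieckAbelian.{v} C]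
    (G : Type v) [Group G] (hG : IsSofic G) (N : C) [IsNoetherianObject N] :
    IsDedekindFiniteMonoid (End ((inductionFunctor (C := C) G).obj N)) := by
  rw [inductionFunctor_obj]
  have := isDedekindFiniteMonoid_monoidAlgebra_end hG N
  exact .of_injective (inducedRepEndHom G N) inducedRepEndHom_injective
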